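/- **Setting.** Consider Guarded Computational Type Theory, interpreted in the presheaf topos $\mathcal S=\mathrm{Psh}(\mathbb W)$. Objects (*worlds*) $U$ of $\mathbb W$ are non-empty finite sets of clock names together with a time $\partial_U(\kappa)\in\mathbb N$ for each name $\kappa$. A morphism $V\to U$ is a function $f$ from the names of $U$ to the names of $V$ with $\partial_V(f\kappa)\le\partial_U(\kappa)$. $\mathrm{Clk}$ is the presheaf of clock names. The modality $\triangleright_\kappa\varphi$ is forced at $U$ iff $\partial_U(\kappa)=0$, or $\partial_U(\kappa)=n+1$ and $\varphi$ is forced at $U[\kappa\mapsto n]$. *Syntax.* Untyped formal terms are built from variables, $\lambda x.M$, $\lambda k.M$ (clock abstraction), $M\,N$, $M\,k$ (clock application), pairs and projections, $\mathsf{fix}\,x.M$, unit element, booleans, natural numbers, $\mathsf{sup}$, the recursors, and the types $(x:A)\to B$, $(x:A)\times B$, $\mathsf W(x:A).B$, equality types, $\Pi k.A$ (clock product), $\bigcap k.A$ (clock intersection), $\triangleright_k A$, $\mathsf{void}$, $\mathsf{unit}$, $\mathsf{bool}$, $\mathsf{nat}$ and $\mathsf U_i$ ($i\in\mathbb N$).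 Write $A\times B$ for $(x:A)\times B$ with $x$ not free in $B$. An assignment $\varrho\in\mathrm{Clk}^\Delta$ elaborates a formal term over a clock context $\Delta$ to a *program* in $\mathcal S$: the same grammar, with clocks taken from $\mathrm{Clk}$ and clock binding given by the exponential $(-)^{\mathrm{Clk}}$. Closed programs have the usual lazy (call-by-name) operational semantics, in which $\mathsf{fix}\,x.M$ steps to $M[\mathsf{fix}\,x.M/x]$ and $(\lambda k.M)\,\kappa$ steps to $M[\kappa/k]$. *Types.* A candidate type system is, in $\mathcal S$, a relation between closed programs and binary relations on closed programs. For a candidate type system $\sigma$ let $[\sigma]$ be the least one that contains $\sigma$ and is closed, up to evaluation of types to values, under the type formers with the usual behavioural meaning of elements. Dependent functions and pairs are interpreted negatively, by application and projections. $\triangleright_\kappa A$ is interpreted by $\{(M,N)\mid\triangleright_\kappa((M,N)\in\mathcal A)\}$, provided $\triangleright_\kappa(A\text{ is interpreted by }\mathcal A)$. $\bigcap\kappa.A$ is interpreted by $\{(M,N)\mid\forall\kappa.\,(M,N)\in\mathcal A(\kappa)\}$ and $\Pi\kappa.A$ by $\{(M,N)\mid\forall\kappa.\,(M\kappa,N\kappa)\in\mathcal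 A(\kappa)\}$, provided $A(\kappa)$ is interpreted by $\mathcal A(\kappa)$ for all $\kappa$. Put $\tau_n=[\nu_n]$, where $\nu_n$ consists of the universes $\mathsf U_i$ with $i<n$ (up to evaluation), $\mathsf U_i$ being interpreted by $\{(A,B)\mid A,B\text{ have a common interpretation in }\tau_i\}$; put $\tau_\omega=\bigcup_n\tau_n$. *Judgments.* $\Delta\mid\Gamma\vdash M_0=M_1\in A$ means that it is true in $\mathcal S$ that, for every $\varrho\in\mathrm{Clk}^\Delta$, if with respect to $\tau_\omega$ the elaborated context $\Gamma$ is valid and $A$ is a functional family of types over $\Gamma$, then any two similar instantiations $\gamma_0,\gamma_1$ of $\Gamma$ send $M_0,M_1$ to programs $M_0\gamma_0$, $M_1\gamma_1$ related by the relation interpreting $A\gamma_0$. $\Delta\mid\Gamma\vdash M\in A$ abbreviates $\Delta\mid\Gamma\vdash M=M\in A$. **Statement.** Put $$\mathsf{Stream}=\lambda k.\,\mathsf{fix}\,A.\,(\mathsf{bool}\times\triangleright_k A),\qquad \mathsf{Sequence}=\textstyle\bigcap k.\,(\mathsf{Stream}\;k),\qquad \mathsf{ones}=\mathsf{fix}\,x.\,\langle\mathsf{tt},x\rangle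 .$$ Then for every clock context $\Delta$, every universe level $i\in\mathbb N$, and every typing context $\Gamma$ (over $\Delta$ in 1, 2, 4, 6 and over $\Delta,k$ in 3, 5), the following judgments hold: 1. $\Delta\mid\Gamma\vdash\mathsf{Stream}\in\Pi k.\,\mathsf U_i$; 2. $\Delta\mid\Gamma\vdash\mathsf{Sequence}\in\mathsf U_i$; 3. $\Delta,k\mid\Gamma\vdash\mathsf{Stream}\;k=\mathsf{bool}\times\triangleright_k(\mathsf{Stream}\;k)\in\mathsf U_i$; 4. $\Delta\mid\Gamma\vdash\mathsf{Sequence}=\mathsf{bool}\times\mathsf{Sequence}\in\mathsf U_i$; 5. $\Delta,k\mid\Gamma\vdash\mathsf{ones}\in\mathsf{Stream}\;k$; 6. $\Delta\mid\Gamma\vdash\mathsf{ones}\in\mathsf{Sequence}$. -/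

import Mathlib

open CategoryTheory

namespace GCTT

/-! ## The category of clock worlds

A world is a non-empty finite set of clock names together with the time left on each of them.
A morphism `V ⟶ W` is a function from the names of `W` to the names of `V` under which the time
left does not increase. The semantic universe is the topos of presheaves on this category; all
notions below are spelled out through its Kripke-Joyal semantics, a predicate on a presheaf being
a restriction-stable predicate on its elements at all worlds. -/

structure World where
  card : ℕ
  pos : 0 < card
  time : Fin card → ℕ

/-- The elements, at a world, of the object of clock names. -/
abbrev Clk (W : World) : Type := Fin W.card

@[ext]
structure World.Hom (V W : World) where
  names : Clk W → Clk V
  le : ∀ κ, V.time (names κ) ≤ W.time κ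

instance : Category World where
  Hom := World.Hom
  id W := ⟨fun κ => κ, fun _ => le_rfl⟩
  comp σ ρ := ⟨fun κ => σ.names (ρ.names κ), fun κ => (σ.le _).trans (ρ.le κ)⟩

/-- Restriction of clock names along a morphism of worlds. -/
def clkRes {V W : World} (ρ : V ⟶ W) (κ : Clk W) : Clk V := World.Hom.names ρ κ

@[simp] theorem clkRes_id {W : World} (κ : Clk W) : clkRes (𝟙 W) κ = κ := rfl

@[simp] theorem clkRes_comp {V' V W : World} (σ : V' ⟶ V) (ρ : V ⟶ W) (κ : Clk W) :
    clkRes (σ ≫ ρ) κ = clkRes σ (clkRes ρ κ) := rfl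

/-- The world `W[κ ↦ n]`. -/
def World.set (W : World) (κ : Clk W) (n : ℕ) : World where
  card := W.card
  pos := W.pos
  time := Function.update W.time κ n

/-- The morphism `[κ += 1] : W[κ ↦ n] ⟶ W` when the time left on `κ` is `n + 1`. -/
def World.tick {W : World} {κ : Clk W} {n : ℕ} (h : W.time κ = n + 1) : W.set κ n ⟶ W where
  names := fun κ' => κ'
  le := by
    intro κ'
    change Function.update W.time κ n κ' ≤ W.time κ'
    by_cases e : κ' = κ
    · subst e; simp [h]
    · simp [e]

/-- Forcing clause of the later modality: trivial if no time is left on `κ`; if the time left is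
`n + 1`, then `φ` has to hold at `W[κ ↦ n]`. Here `φ` is given by its truth value at all worlds
over `W`. -/
def Later {W : World} (κ : Clk W) (φ : ∀ ⦃V : World⦄, (V ⟶ W) → Prop) : Prop :=
  ∀ (n : ℕ) (h : W.time κ = n + 1), φ (World.tick h)

theorem Later.res {V W : World} (ρ : V ⟶ W) (κ : Clk W)
    {φ : ∀ ⦃V : World⦄, (V ⟶ W) → Prop}
    (hφ : ∀ ⦃V V' : World⦄ (σ : V' ⟶ V) (ρ : V ⟶ W), φ ρ → φ (σ ≫ ρ)) (h : Later κ φ) :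
    Later (clkRes ρ κ) (fun _ σ => φ (σ ≫ ρ)) := by
  intro m hm
  have hle : V.time (clkRes ρ κ) ≤ W.time κ := World.Hom.le ρ κ
  obtain ⟨n, hn⟩ : ∃ n, W.time κ = n + 1 := ⟨W.time κ - 1, by omega⟩
  let σ : V.set (clkRes ρ κ) m ⟶ W.set κ n :=
    { names := fun κ' => clkRes (V := V) (W := W) ρ κ'
      le := by
        intro (κ' : Clk W)
        change Function.update V.time (clkRes ρ κ) m (clkRes ρ κ')
          ≤ Function.update W.time κ n κ'
        have h1 : V.time (clkRes ρ κ') ≤ W.time κ' := World.Hom.le ρ κ'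
        by_cases e : κ' = κ
        · subst e; simp; omega
        · by_cases e' : clkRes ρ κ' = clkRes ρ κ
          · rw [e'] at h1 ⊢; simp [e]; omega
          · simpa [e, e'] using h1 }
  have e : World.tick hm ≫ ρ = σ ≫ World.tick hn := rfl
  change φ (World.tick hm ≫ ρ)
  rw [e]
  exact hφ σ _ (h n hn)

/-! ## Formal terms

Well-scoped de Bruijn syntax with `l` free clocks and `n` free variables; index `0` is the most
recently bound one. -/

inductive FTm : ℕ → ℕ → Type
  | var {l n} (i : Fin n) : FTm l n
  | lam {l n} (M : FTm l (n + 1)) : FTm l n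
  | klam {l n} (M : FTm (l + 1) n) : FTm l n
  | app {l n} (M N : FTm l n) : FTm l n
  | kapp {l n} (M : FTm l n) (k : Fin l) : FTm l n
  | pair {l n} (M N : FTm l n) : FTm l n
  | fst {l n} (M : FTm l n) : FTm l n
  | snd {l n} (M : FTm l n) : FTm l n
  | fix {l n} (M : FTm l (n + 1)) : FTm l n
  | star {l n} : FTm l n
  | tt {l n} : FTm l n
  | ff {l n} : FTm l n
  | ite {l n} (M N O : FTm l n) : FTm l n
  | ze {l n} : FTm l n
  | su {l n} (M : FTm l n) : FTm l n
  | ifze {l n} (M N : FTm l n) (O : FTm l (n + 1)) : FTm l n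
  | sup {l n} (M : FTm l n) (N : FTm l (n + 1)) : FTm l n
  | wrec {l n} (M : FTm l n) (N : FTm l (n + 3)) : FTm l n
  | pi {l n} (A : FTm l n) (B : FTm l (n + 1)) : FTm l n
  | sg {l n} (A : FTm l n) (B : FTm l (n + 1)) : FTm l n
  | wty {l n} (A : FTm l n) (B : FTm l (n + 1)) : FTm l n
  | eq {l n} (A M N : FTm l n) : FTm l n
  | kprod {l n} (A : FTm (l + 1) n) : FTm l n
  | isect {l n} (A : FTm (l + 1) n) : FTm l n
  | later {l n} (k : Fin l) (A : FTm l n) : FTm l n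
  | void {l n} : FTm l n
  | unit {l n} : FTm l n
  | bool {l n} : FTm l n
  | nat {l n} : FTm l n
  | univ {l n} (i : ℕ) : FTm l n

/-- A renaming of variables, extended under a binder. -/
def liftRen {m n : ℕ} (r : Fin m → Fin n) : Fin (m + 1) → Fin (n + 1) :=
  Fin.cons 0 (fun i => (r i).succ)

/-- Renaming of variables in formal terms. -/
def FTm.rename : {l m n : ℕ} → (Fin m → Fin n) → FTm l m → FTm l n
  | _, _, _, r, .var i => .var (r i)
  | _, _, _, r, .lam M => .lam (M.rename (liftRen r))
  | _, _, _, r, .klam M => .klam (M.rename r)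
  | _, _, _, r, .app M N => .app (M.rename r) (N.rename r)
  | _, _, _, r, .kapp M k => .kapp (M.rename r) k
  | _, _, _, r, .pair M N => .pair (M.rename r) (N.rename r)
  | _, _, _, r, .fst M => .fst (M.rename r)
  | _, _, _, r, .snd M => .snd (M.rename r)
  | _, _, _, r, .fix M => .fix (M.rename (liftRen r))
  | _, _, _, _, .star => .star
  | _, _, _, _, .tt => .tt
  | _, _, _, _, .ff => .ff
  | _, _, _, r, .ite M N O => .ite (M.rename r) (N.rename r) (O.rename r)
  | _, _, _, _, .ze => .ze
  | _, _, _, r, .su M => .su (M.rename r)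
  | _, _, _, r, .ifze M N O => .ifze (M.rename r) (N.rename r) (O.rename (liftRen r))
  | _, _, _, r, .sup M N => .sup (M.rename r) (N.rename (liftRen r))
  | _, _, _, r, .wrec M N => .wrec (M.rename r) (N.rename (liftRen (liftRen (liftRen r))))
  | _, _, _, r, .pi A B => .pi (A.rename r) (B.rename (liftRen r))
  | _, _, _, r, .sg A B => .sg (A.rename r) (B.rename (liftRen r))
  | _, _, _, r, .wty A B => .wty (A.rename r) (B.rename (liftRen r))
  | _, _, _, r, .eq A M N => .eq (A.rename r) (M.rename r) (N.rename r)
  | _, _, _, r, .kprod A => .kprod (A.rename r)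
  | _, _, _, r, .isect A => .isect (A.rename r)
  | _, _, _, r, .later k A => .later k (A.rename r)
  | _, _, _, _, .void => .void
  | _, _, _, _, .unit => .unit
  | _, _, _, _, .bool => .bool
  | _, _, _, _, .nat => .nat
  | _, _, _, _, .univ i => .univ i

/-- The non-dependent product `A × B`, i.e. `(x : A) × B` with `x` not free in `B`. -/
def FTm.prod {l n : ℕ} (A B : FTm l n) : FTm l n := .sg A (B.rename Fin.succ)

/-- Typing contexts with `l` free clocks and `n` variables. -/
inductive FCtx (l : ℕ) : ℕ → Type
  | nil : FCtx l 0
  | snoc {n} (Γ : FCtx l n) (A : FTm l n) : FCtx l (n + 1)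

/-! ## Programs

Programs form an inductive family of presheaves on `World` in which clocks are elements of the
object of clock names and the binding of a clock is an element of the exponential by that object.
At a world `W`, such an exponential consists of the natural families of programs indexed by the
worlds `V ⟶ W` and the clocks of `V`. We first take arbitrary families (`Raw`) and then keep the
trees all of whose families are natural (`Raw.Natural`, `Prog`), which is the standard
construction of inductive types in a presheaf topos. -/

inductive Raw : World → ℕ → Type
  | var {W n} (i : Fin n) : Raw W n
  | lam {W n} (M : Raw W (n + 1)) : Raw W n
  | klam {W n} (M : ∀ V : World, (V ⟶ W) → Clk V → Raw V n) : Raw W n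
  | app {W n} (M N : Raw W n) : Raw W n
  | kapp {W n} (M : Raw W n) (κ : Clk W) : Raw W n
  | pair {W n} (M N : Raw W n) : Raw W n
  | fst {W n} (M : Raw W n) : Raw W n
  | snd {W n} (M : Raw W n) : Raw W n
  | fix {W n} (M : Raw W (n + 1)) : Raw W n
  | star {W n} : Raw W n
  | tt {W n} : Raw W n
  | ff {W n} : Raw W n
  | ite {W n} (M N O : Raw W n) : Raw W n
  | ze {W n} : Raw W n
  | su {W n} (M : Raw W n) : Raw W n
  | ifze {W n} (M N : Raw W n) (O : Raw W (n + 1)) : Raw W n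
  | sup {W n} (M : Raw W n) (N : Raw W (n + 1)) : Raw W n
  | wrec {W n} (M : Raw W n) (N : Raw W (n + 3)) : Raw W n
  | pi {W n} (A : Raw W n) (B : Raw W (n + 1)) : Raw W n
  | sg {W n} (A : Raw W n) (B : Raw W (n + 1)) : Raw W n
  | wty {W n} (A : Raw W n) (B : Raw W (n + 1)) : Raw W n
  | eq {W n} (A M N : Raw W n) : Raw W n
  | kprod {W n} (A : ∀ V : World, (V ⟶ W) → Clk V → Raw V n) : Raw W n
  | isect {W n} (A : ∀ V : World, (V ⟶ W) → Clk V → Raw V n) : Raw W n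
  | later {W n} (κ : Clk W) (A : Raw W n) : Raw W n
  | void {W n} : Raw W n
  | unit {W n} : Raw W n
  | bool {W n} : Raw W n
  | nat {W n} : Raw W n
  | univ {W n} (i : ℕ) : Raw W n

/-- Restriction of programs along a morphism of worlds. -/
def Raw.restrict : {V W : World} → {n : ℕ} → (V ⟶ W) → Raw W n → Raw V n
  | _, _, _, _, .var i => .var i
  | _, _, _, ρ, .lam M => .lam (M.restrict ρ)
  | _, _, _, ρ, .klam M => .klam (fun V' σ κ => M V' (σ ≫ ρ) κ)
  | _, _, _, ρ, .app M N => .app (M.restrict ρ) (N.restrict ρ)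
  | _, _, _, ρ, .kapp M κ => .kapp (M.restrict ρ) (clkRes ρ κ)
  | _, _, _, ρ, .pair M N => .pair (M.restrict ρ) (N.restrict ρ)
  | _, _, _, ρ, .fst M => .fst (M.restrict ρ)
  | _, _, _, ρ, .snd M => .snd (M.restrict ρ)
  | _, _, _, ρ, .fix M => .fix (M.restrict ρ)
  | _, _, _, _, .star => .star
  | _, _, _, _, .tt => .tt
  | _, _, _, _, .ff => .ff
  | _, _, _, ρ, .ite M N O => .ite (M.restrict ρ) (N.restrict ρ) (O.restrict ρ)
  | _, _, _, _, .ze => .ze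
  | _, _, _, ρ, .su M => .su (M.restrict ρ)
  | _, _, _, ρ, .ifze M N O => .ifze (M.restrict ρ) (N.restrict ρ) (O.restrict ρ)
  | _, _, _, ρ, .sup M N => .sup (M.restrict ρ) (N.restrict ρ)
  | _, _, _, ρ, .wrec M N => .wrec (M.restrict ρ) (N.restrict ρ)
  | _, _, _, ρ, .pi A B => .pi (A.restrict ρ) (B.restrict ρ)
  | _, _, _, ρ, .sg A B => .sg (A.restrict ρ) (B.restrict ρ)
  | _, _, _, ρ, .wty A B => .wty (A.restrict ρ) (B.restrict ρ)
  | _, _, _, ρ, .eq A M N => .eq (A.restrict ρ) (M.restrict ρ) (N.restrict ρ)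
  | _, _, _, ρ, .kprod A => .kprod (fun V' σ κ => A V' (σ ≫ ρ) κ)
  | _, _, _, ρ, .isect A => .isect (fun V' σ κ => A V' (σ ≫ ρ) κ)
  | _, _, _, ρ, .later κ A => .later (clkRes ρ κ) (A.restrict ρ)
  | _, _, _, _, .void => .void
  | _, _, _, _, .unit => .unit
  | _, _, _, _, .bool => .bool
  | _, _, _, _, .nat => .nat
  | _, _, _, _, .univ i => .univ i

/-- Every clock-indexed family occurring in the program is natural. -/
def Raw.Natural : {W : World} → {n : ℕ} → Raw W n → Prop
  | _, _, .var _ => True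
  | _, _, .lam M => M.Natural
  | W, _, .klam M => (∀ V (ρ : V ⟶ W) κ, (M V ρ κ).Natural) ∧
      ∀ V (ρ : V ⟶ W) κ V' (σ : V' ⟶ V), (M V ρ κ).restrict σ = M V' (σ ≫ ρ) (clkRes σ κ)
  | _, _, .app M N => M.Natural ∧ N.Natural
  | _, _, .kapp M _ => M.Natural
  | _, _, .pair M N => M.Natural ∧ N.Natural
  | _, _, .fst M => M.Natural
  | _, _, .snd M => M.Natural
  | _, _, .fix M => M.Natural
  | _, _, .star => True
  | _, _, .tt => True
  | _, _, .ff => True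
  | _, _, .ite M N O => M.Natural ∧ N.Natural ∧ O.Natural
  | _, _, .ze => True
  | _, _, .su M => M.Natural
  | _, _, .ifze M N O => M.Natural ∧ N.Natural ∧ O.Natural
  | _, _, .sup M N => M.Natural ∧ N.Natural
  | _, _, .wrec M N => M.Natural ∧ N.Natural
  | _, _, .pi A B => A.Natural ∧ B.Natural
  | _, _, .sg A B => A.Natural ∧ B.Natural
  | _, _, .wty A B => A.Natural ∧ B.Natural
  | _, _, .eq A M N => A.Natural ∧ M.Natural ∧ N.Natural
  | W, _, .kprod A => (∀ V (ρ : V ⟶ W) κ, (A V ρ κ).Natural) ∧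
      ∀ V (ρ : V ⟶ W) κ V' (σ : V' ⟶ V), (A V ρ κ).restrict σ = A V' (σ ≫ ρ) (clkRes σ κ)
  | W, _, .isect A => (∀ V (ρ : V ⟶ W) κ, (A V ρ κ).Natural) ∧
      ∀ V (ρ : V ⟶ W) κ V' (σ : V' ⟶ V), (A V ρ κ).restrict σ = A V' (σ ≫ ρ) (clkRes σ κ)
  | _, _, .later _ A => A.Natural
  | _, _, .void => True
  | _, _, .unit => True
  | _, _, .bool => True
  | _, _, .nat => True
  | _, _, .univ _ => True

/-- Renaming of variables. -/
def Raw.rename : {W : World} → {m n : ℕ} → (Fin m → Fin n) → Raw W m → Raw W n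
  | _, _, _, r, .var i => .var (r i)
  | _, _, _, r, .lam M => .lam (M.rename (liftRen r))
  | _, _, _, r, .klam M => .klam (fun V σ κ => (M V σ κ).rename r)
  | _, _, _, r, .app M N => .app (M.rename r) (N.rename r)
  | _, _, _, r, .kapp M κ => .kapp (M.rename r) κ
  | _, _, _, r, .pair M N => .pair (M.rename r) (N.rename r)
  | _, _, _, r, .fst M => .fst (M.rename r)
  | _, _, _, r, .snd M => .snd (M.rename r)
  | _, _, _, r, .fix M => .fix (M.rename (liftRen r))
  | _, _, _, _, .star => .star
  | _, _, _, _, .tt => .tt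
  | _, _, _, _, .ff => .ff
  | _, _, _, r, .ite M N O => .ite (M.rename r) (N.rename r) (O.rename r)
  | _, _, _, _, .ze => .ze
  | _, _, _, r, .su M => .su (M.rename r)
  | _, _, _, r, .ifze M N O => .ifze (M.rename r) (N.rename r) (O.rename (liftRen r))
  | _, _, _, r, .sup M N => .sup (M.rename r) (N.rename (liftRen r))
  | _, _, _, r, .wrec M N => .wrec (M.rename r) (N.rename (liftRen (liftRen (liftRen r))))
  | _, _, _, r, .pi A B => .pi (A.rename r) (B.rename (liftRen r))
  | _, _, _, r, .sg A B => .sg (A.rename r) (B.rename (liftRen r))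
  | _, _, _, r, .wty A B => .wty (A.rename r) (B.rename (liftRen r))
  | _, _, _, r, .eq A M N => .eq (A.rename r) (M.rename r) (N.rename r)
  | _, _, _, r, .kprod A => .kprod (fun V σ κ => (A V σ κ).rename r)
  | _, _, _, r, .isect A => .isect (fun V σ κ => (A V σ κ).rename r)
  | _, _, _, r, .later κ A => .later κ (A.rename r)
  | _, _, _, _, .void => .void
  | _, _, _, _, .unit => .unit
  | _, _, _, _, .bool => .bool
  | _, _, _, _, .nat => .nat
  | _, _, _, _, .univ i => .univ i

/-- A substitution, extended under a binder. -/
def Raw.lift {W : World} {m n : ℕ} (γ : Fin m → Raw W n) : Fin (m + 1) → Raw W (n + 1) :=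
  Fin.cons (.var 0) (fun i => (γ i).rename Fin.succ)

/-- Simultaneous substitution. -/
def Raw.subst : {W : World} → {m n : ℕ} → (Fin m → Raw W n) → Raw W m → Raw W n
  | _, _, _, γ, .var i => γ i
  | _, _, _, γ, .lam M => .lam (M.subst (lift γ))
  | _, _, _, γ, .klam M => .klam (fun V σ κ => (M V σ κ).subst (fun i => (γ i).restrict σ))
  | _, _, _, γ, .app M N => .app (M.subst γ) (N.subst γ)
  | _, _, _, γ, .kapp M κ => .kapp (M.subst γ) κ
  | _, _, _, γ, .pair M N => .pair (M.subst γ) (N.subst γ)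
  | _, _, _, γ, .fst M => .fst (M.subst γ)
  | _, _, _, γ, .snd M => .snd (M.subst γ)
  | _, _, _, γ, .fix M => .fix (M.subst (lift γ))
  | _, _, _, _, .star => .star
  | _, _, _, _, .tt => .tt
  | _, _, _, _, .ff => .ff
  | _, _, _, γ, .ite M N O => .ite (M.subst γ) (N.subst γ) (O.subst γ)
  | _, _, _, _, .ze => .ze
  | _, _, _, γ, .su M => .su (M.subst γ)
  | _, _, _, γ, .ifze M N O => .ifze (M.subst γ) (N.subst γ) (O.subst (lift γ))
  | _, _, _, γ, .sup M N => .sup (M.subst γ) (N.subst (lift γ))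
  | _, _, _, γ, .wrec M N => .wrec (M.subst γ) (N.subst (lift (lift (lift γ))))
  | _, _, _, γ, .pi A B => .pi (A.subst γ) (B.subst (lift γ))
  | _, _, _, γ, .sg A B => .sg (A.subst γ) (B.subst (lift γ))
  | _, _, _, γ, .wty A B => .wty (A.subst γ) (B.subst (lift γ))
  | _, _, _, γ, .eq A M N => .eq (A.subst γ) (M.subst γ) (N.subst γ)
  | _, _, _, γ, .kprod A => .kprod (fun V σ κ => (A V σ κ).subst (fun i => (γ i).restrict σ))
  | _, _, _, γ, .isect A => .isect (fun V σ κ => (A V σ κ).subst (fun i => (γ i).restrict σ))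
  | _, _, _, γ, .later κ A => .later κ (A.subst γ)
  | _, _, _, _, .void => .void
  | _, _, _, _, .unit => .unit
  | _, _, _, _, .bool => .bool
  | _, _, _, _, .nat => .nat
  | _, _, _, _, .univ i => .univ i

/-- Substitution of a closed program for the only free variable. -/
def Raw.inst {W : World} (B : Raw W 1) (M : Raw W 0) : Raw W 0 := B.subst (fun _ => M)

theorem Raw.restrict_id {W : World} {n : ℕ} (M : Raw W n) : M.restrict (𝟙 W) = M := by
  induction M <;> simp_all [Raw.restrict]

theorem Raw.restrict_comp {V' V W : World} {n : ℕ} (σ : V' ⟶ V) (ρ : V ⟶ W) (M : Raw W n) :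
    (M.restrict ρ).restrict σ = M.restrict (σ ≫ ρ) := by
  induction M generalizing V V' <;> simp_all [Raw.restrict]

theorem Raw.Natural.restrict {V W : World} {n : ℕ} (ρ : V ⟶ W) {M : Raw W n} (h : M.Natural) :
    (M.restrict ρ).Natural := by
  induction M generalizing V <;> simp_all [Raw.restrict, Raw.Natural]

theorem Raw.rename_restrict {V W : World} {m n : ℕ} (ρ : V ⟶ W) (r : Fin m → Fin n)
    (M : Raw W m) : (M.rename r).restrict ρ = (M.restrict ρ).rename r := by
  induction M generalizing V n <;> simp_all [Raw.restrict, Raw.rename]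

theorem Raw.Natural.rename {W : World} {m n : ℕ} (r : Fin m → Fin n) {M : Raw W m}
    (h : M.Natural) : (M.rename r).Natural := by
  induction M generalizing n <;> simp_all [Raw.rename, Raw.Natural, Raw.rename_restrict]

theorem Raw.lift_restrict {V W : World} {m n : ℕ} (ρ : V ⟶ W) (γ : Fin m → Raw W n) :
    (fun i => (Raw.lift γ i).restrict ρ) = Raw.lift (fun i => (γ i).restrict ρ) := by
  funext i
  refine Fin.cases ?_ (fun j => ?_) i
  · rfl
  · simp [Raw.lift, Raw.rename_restrict]

theorem Raw.subst_restrict {V W : World} {m n : ℕ} (ρ : V ⟶ W) (γ : Fin m → Raw W n)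
    (M : Raw W m) :
    (M.subst γ).restrict ρ = (M.restrict ρ).subst (fun i => (γ i).restrict ρ) := by
  induction M generalizing V n <;>
    simp_all [Raw.restrict, Raw.subst, Raw.restrict_comp, Raw.lift_restrict]

theorem Raw.Natural.lift {W : World} {m n : ℕ} {γ : Fin m → Raw W n}
    (hγ : ∀ i, (γ i).Natural) (i : Fin (m + 1)) : (Raw.lift γ i).Natural := by
  refine Fin.cases ?_ (fun j => ?_) i
  · trivial
  · simpa [Raw.lift] using (hγ j).rename Fin.succ

theorem Raw.Natural.subst {W : World} {m n : ℕ} {γ : Fin m → Raw W n}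
    (hγ : ∀ i, (γ i).Natural) {M : Raw W m} (h : M.Natural) : (M.subst γ).Natural := by
  induction M generalizing n <;>
    simp_all [Raw.subst, Raw.Natural, Raw.Natural.lift, Raw.Natural.restrict,
      Raw.subst_restrict, Raw.restrict_comp]
  case wrec ih => exact ih (fun i => Raw.Natural.lift (Raw.Natural.lift (Raw.Natural.lift hγ)) i)

/-- The programs with `n` free variables at the world `W`. -/
def Prog (W : World) (n : ℕ) : Type := {M : Raw W n // M.Natural}

namespace Prog

@[ext] theorem ext {W : World} {n : ℕ} {M N : Prog W n} (h : M.1 = N.1) : M = N := Subtype.ext h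

def res {V W : World} {n : ℕ} (ρ : V ⟶ W) (M : Prog W n) : Prog V n :=
  ⟨M.1.restrict ρ, M.2.restrict ρ⟩

theorem res_id {W : World} {n : ℕ} (M : Prog W n) : M.res (𝟙 W) = M :=
  ext M.1.restrict_id

theorem res_comp {V' V W : World} {n : ℕ} (σ : V' ⟶ V) (ρ : V ⟶ W) (M : Prog W n) :
    (M.res ρ).res σ = M.res (σ ≫ ρ) :=
  ext (Raw.restrict_comp σ ρ M.1)

def subst {W : World} {m n : ℕ} (γ : Fin m → Prog W n) (M : Prog W m) : Prog W n :=
  ⟨M.1.subst (fun i => (γ i).1), Raw.Natural.subst (fun i => (γ i).2) M.2⟩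

def inst {W : World} (B : Prog W 1) (M : Prog W 0) : Prog W 0 :=
  ⟨B.1.inst M.1, Raw.Natural.subst (fun _ => M.2) B.2⟩

theorem inst_res {V W : World} (ρ : V ⟶ W) (B : Prog W 1) (M : Prog W 0) :
    (B.inst M).res ρ = (B.res ρ).inst (M.res ρ) :=
  ext (Raw.subst_restrict ρ _ B.1)

def fst {W : World} (M : Prog W 0) : Prog W 0 := ⟨.fst M.1, M.2⟩

def snd {W : World} (M : Prog W 0) : Prog W 0 := ⟨.snd M.1, M.2⟩

def app {W : World} (M N : Prog W 0) : Prog W 0 := ⟨.app M.1 N.1, M.2, N.2⟩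

def kapp {W : World} (M : Prog W 0) (κ : Clk W) : Prog W 0 := ⟨.kapp M.1 κ, M.2⟩

end Prog

/-- Elements at `W` of the exponential of closed programs by the object of clock names. -/
structure ClkProg (W : World) where
  app : ∀ ⦃V : World⦄, (V ⟶ W) → Clk V → Prog V 0
  nat : ∀ ⦃V V' : World⦄ (σ : V' ⟶ V) (ρ : V ⟶ W) (κ : Clk V),
    (app ρ κ).res σ = app (σ ≫ ρ) (clkRes σ κ)

namespace ClkProg

def res {V W : World} (ρ : V ⟶ W) (A : ClkProg W) : ClkProg V where
  app _ σ κ := A.app (σ ≫ ρ) κ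
  nat _ _ σ' σ κ := by simpa using A.nat σ' (σ ≫ ρ) κ

/-- The underlying family, as it occurs below `Raw.klam`, `Raw.kprod` and `Raw.isect`. -/
def raw {W : World} (A : ClkProg W) : ∀ V : World, (V ⟶ W) → Clk V → Raw V 0 :=
  fun _ ρ κ => (A.app ρ κ).1

end ClkProg

/-! ## Operational semantics -/

/-- Closed values: all introduction forms and all types. -/
def Raw.IsVal {W : World} : Raw W 0 → Prop
  | .app _ _ => False
  | .kapp _ _ => False
  | .fst _ => False
  | .snd _ => False
  | .fix _ => False
  | .ite _ _ _ => False
  | .ifze _ _ _ => False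
  | .wrec _ _ => False
  | _ => True

/-- Structural operational semantics of closed programs. -/
inductive Step {W : World} : Raw W 0 → Raw W 0 → Prop
  | app_cong {M M' N} : Step M M' → Step (.app M N) (.app M' N)
  | kapp_cong {M M' κ} : Step M M' → Step (.kapp M κ) (.kapp M' κ)
  | fst_cong {M M'} : Step M M' → Step (.fst M) (.fst M')
  | snd_cong {M M'} : Step M M' → Step (.snd M) (.snd M')
  | ite_cong {M M' N O} : Step M M' → Step (.ite M N O) (.ite M' N O)
  | ifze_cong {M M' N O} : Step M M' → Step (.ifze M N O) (.ifze M' N O)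
  | wrec_cong {M M' N} : Step M M' → Step (.wrec M N) (.wrec M' N)
  | app_lam {M N} : Step (.app (.lam M) N) (M.inst N)
  | kapp_klam {M κ} : Step (.kapp (.klam M) κ) (M W (𝟙 W) κ)
  | fst_pair {M N} : Step (.fst (.pair M N)) M
  | snd_pair {M N} : Step (.snd (.pair M N)) N
  | ite_tt {N O} : Step (.ite .tt N O) N
  | ite_ff {N O} : Step (.ite .ff N O) O
  | ifze_ze {N O} : Step (.ifze .ze N O) N
  | ifze_su {M N O} : Step (.ifze (.su M) N O) (O.inst M)
  /-- The three variables of the recursor are instantiated by the label, by the function sending a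
  branching to the corresponding subtree, and by the function sending a branching to the result of
  the recursion on that subtree. -/
  | wrec_sup {M N O} : Step (.wrec (.sup M N) O)
      (O.subst ![.lam (.wrec N (O.rename Fin.castSucc)), .lam N, M])
  | fix {M} : Step (.fix M) (M.inst (.fix M))

/-- `M` evaluates to the value `v`. -/
def Prog.Eval {W : World} (M v : Prog W 0) : Prop :=
  Relation.ReflTransGen Step M.1 v.1 ∧ v.1.IsVal

theorem Raw.IsVal.restrict {V W : World} (ρ : V ⟶ W) {M : Raw W 0} (h : M.IsVal) :
    (M.restrict ρ).IsVal := by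
  cases M <;> simp_all [Raw.IsVal, Raw.restrict]

theorem Step.natural {W : World} {M N : Raw W 0} (h : Step M N) (hM : M.Natural) :
    N.Natural := by
  induction h with
  | app_lam => exact Raw.Natural.subst (fun _ => hM.2) hM.1
  | kapp_klam => exact hM.1 _ _ _
  | @ifze_su M N O => exact Raw.Natural.subst (γ := fun _ => M) (fun _ => hM.1) hM.2.2
  | wrec_sup =>
    obtain ⟨⟨h1, h2⟩, h3⟩ := hM
    refine Raw.Natural.subst (fun i => ?_) h3
    fin_cases i
    · exact ⟨h2, h3.rename _⟩
    · exact h2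
    · exact h1
  | fix => exact Raw.Natural.subst (fun _ => hM) hM
  | _ => simp_all [Raw.Natural]

theorem Step.restrict {V W : World} (ρ : V ⟶ W) {M N : Raw W 0} (hM : M.Natural)
    (h : Step M N) : Step (M.restrict ρ) (N.restrict ρ) := by
  induction h with
  | app_lam =>
    rw [Raw.inst, Raw.subst_restrict]; exact Step.app_lam
  | kapp_klam =>
    rw [hM.2]
    exact Step.kapp_klam
  | ifze_su =>
    rw [Raw.inst, Raw.subst_restrict]; exact Step.ifze_su
  | @wrec_sup M N O =>
    rw [Raw.subst_restrict]
    have := @Step.wrec_sup V (M.restrict ρ) (N.restrict ρ) (O.restrict ρ)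
    refine cast (congrArg (fun γ => Step _ (Raw.subst γ _)) ?_) this
    funext i
    fin_cases i
    · simp [Raw.restrict, Raw.rename_restrict]
    · rfl
    · rfl
  | fix =>
    rw [Raw.inst, Raw.subst_restrict]; exact Step.fix
  | app_cong _ ih => exact Step.app_cong (ih hM.1)
  | kapp_cong _ ih => exact Step.kapp_cong (ih hM)
  | fst_cong _ ih => exact Step.fst_cong (ih hM)
  | snd_cong _ ih => exact Step.snd_cong (ih hM)
  | ite_cong _ ih => exact Step.ite_cong (ih hM.1)
  | ifze_cong _ ih => exact Step.ifze_cong (ih hM.1)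
  | wrec_cong _ ih => exact Step.wrec_cong (ih hM.1)
  | fst_pair => exact Step.fst_pair
  | snd_pair => exact Step.snd_pair
  | ite_tt => exact Step.ite_tt
  | ite_ff => exact Step.ite_ff
  | ifze_ze => exact Step.ifze_ze

theorem Prog.Eval.res {V W : World} (ρ : V ⟶ W) {M v : Prog W 0} (h : M.Eval v) :
    (M.res ρ).Eval (v.res ρ) := by
  refine ⟨?_, h.2.restrict ρ⟩
  have key : ∀ v' : Raw W 0, Relation.ReflTransGen Step M.1 v' →
      v'.Natural ∧ Relation.ReflTransGen Step (M.1.restrict ρ) (v'.restrict ρ) := by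
    intro v' hv
    induction hv with
    | refl => exact ⟨M.2, .refl⟩
    | tail _ hs ih => exact ⟨hs.natural ih.1, ih.2.tail (hs.restrict ρ ih.1)⟩
  exact (key _ h.1).2

/-! ## Elaboration of formal terms into programs -/

/-- The elaboration of a formal term, at an assignment of clocks to its free formal clocks. -/
def FTm.semRaw : {l n : ℕ} → FTm l n → {W : World} → (Fin l → Clk W) → Raw W n
  | _, _, .var i, _, _ => .var i
  | _, _, .lam M, _, ϱ => .lam (M.semRaw ϱ)
  | _, _, .klam M, _, ϱ => .klam (fun V σ κ =>
      M.semRaw (Fin.cons κ (fun k => clkRes σ (ϱ k)) : Fin _ → Clk V))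
  | _, _, .app M N, _, ϱ => .app (M.semRaw ϱ) (N.semRaw ϱ)
  | _, _, .kapp M k, _, ϱ => .kapp (M.semRaw ϱ) (ϱ k)
  | _, _, .pair M N, _, ϱ => .pair (M.semRaw ϱ) (N.semRaw ϱ)
  | _, _, .fst M, _, ϱ => .fst (M.semRaw ϱ)
  | _, _, .snd M, _, ϱ => .snd (M.semRaw ϱ)
  | _, _, .fix M, _, ϱ => .fix (M.semRaw ϱ)
  | _, _, .star, _, _ => .star
  | _, _, .tt, _, _ => .tt
  | _, _, .ff, _, _ => .ff
  | _, _, .ite M N O, _, ϱ => .ite (M.semRaw ϱ) (N.semRaw ϱ) (O.semRaw ϱ)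
  | _, _, .ze, _, _ => .ze
  | _, _, .su M, _, ϱ => .su (M.semRaw ϱ)
  | _, _, .ifze M N O, _, ϱ => .ifze (M.semRaw ϱ) (N.semRaw ϱ) (O.semRaw ϱ)
  | _, _, .sup M N, _, ϱ => .sup (M.semRaw ϱ) (N.semRaw ϱ)
  | _, _, .wrec M N, _, ϱ => .wrec (M.semRaw ϱ) (N.semRaw ϱ)
  | _, _, .pi A B, _, ϱ => .pi (A.semRaw ϱ) (B.semRaw ϱ)
  | _, _, .sg A B, _, ϱ => .sg (A.semRaw ϱ) (B.semRaw ϱ)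
  | _, _, .wty A B, _, ϱ => .wty (A.semRaw ϱ) (B.semRaw ϱ)
  | _, _, .eq A M N, _, ϱ => .eq (A.semRaw ϱ) (M.semRaw ϱ) (N.semRaw ϱ)
  | _, _, .kprod A, _, ϱ => .kprod (fun V σ κ =>
      A.semRaw (Fin.cons κ (fun k => clkRes σ (ϱ k)) : Fin _ → Clk V))
  | _, _, .isect A, _, ϱ => .isect (fun V σ κ =>
      A.semRaw (Fin.cons κ (fun k => clkRes σ (ϱ k)) : Fin _ → Clk V))
  | _, _, .later k A, _, ϱ => .later (ϱ k) (A.semRaw ϱ)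
  | _, _, .void, _, _ => .void
  | _, _, .unit, _, _ => .unit
  | _, _, .bool, _, _ => .bool
  | _, _, .nat, _, _ => .nat
  | _, _, .univ i, _, _ => .univ i

theorem clkRes_cons {V V' : World} {l : ℕ} (σ : V' ⟶ V) (κ : Clk V) (ϱ : Fin l → Clk V) :
    (fun k => clkRes σ ((Fin.cons κ ϱ : Fin (l + 1) → Clk V) k)) =
      (Fin.cons (clkRes σ κ) (fun k => clkRes σ (ϱ k)) : Fin (l + 1) → Clk V') := by
  funext k
  refine Fin.cases ?_ (fun j => ?_) k <;> rfl

theorem FTm.semRaw_restrict {V W : World} {l n : ℕ} (ρ : V ⟶ W) (M : FTm l n)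
    (ϱ : Fin l → Clk W) :
    (M.semRaw ϱ).restrict ρ = M.semRaw (fun k => clkRes ρ (ϱ k)) := by
  induction M generalizing V W <;> simp_all [FTm.semRaw, Raw.restrict]

theorem FTm.semRaw_natural {W : World} {l n : ℕ} (M : FTm l n) (ϱ : Fin l → Clk W) :
    (M.semRaw ϱ).Natural := by
  induction M generalizing W <;>
    simp_all [FTm.semRaw, Raw.Natural, FTm.semRaw_restrict, clkRes_cons]

def FTm.sem {l n : ℕ} (M : FTm l n) {W : World} (ϱ : Fin l → Clk W) : Prog W n :=
  ⟨M.semRaw ϱ, M.semRaw_natural ϱ⟩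

/-- Telescopes of programs. -/
inductive Tele (W : World) : ℕ → Type
  | nil : Tele W 0
  | snoc {n} (Γ : Tele W n) (A : Prog W n) : Tele W (n + 1)

def Tele.res {V W : World} (ρ : V ⟶ W) : {n : ℕ} → Tele W n → Tele V n
  | _, .nil => .nil
  | _, .snoc Γ A => .snoc (Γ.res ρ) (A.res ρ)

def FCtx.sem {l : ℕ} {W : World} (ϱ : Fin l → Clk W) : {n : ℕ} → FCtx l n → Tele W n
  | _, .nil => .nil
  | _, .snoc Γ A => .snoc (Γ.sem ϱ) (A.sem ϱ)

/-! ## Relations on closed programs -/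

/-- Elements at `W` of the power object of pairs of closed programs. -/
@[ext]
structure Rel (W : World) where
  holds : ∀ ⦃V : World⦄, (V ⟶ W) → Prog V 0 → Prog V 0 → Prop
  mono : ∀ ⦃V V' : World⦄ (σ : V' ⟶ V) (ρ : V ⟶ W) (M N : Prog V 0),
    holds ρ M N → holds (σ ≫ ρ) (M.res σ) (N.res σ)

namespace Rel

def res {V W : World} (ρ : V ⟶ W) (R : Rel W) : Rel V where
  holds _ σ M N := R.holds (σ ≫ ρ) M N
  mono _ _ σ' σ M N h := by simpa using R.mono σ' (σ ≫ ρ) M N h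

/-- `(M, N) ∈ R` at the world at which `R` lives. -/
def mem {W : World} (R : Rel W) (M N : Prog W 0) : Prop := R.holds (𝟙 W) M N

theorem mem_res {V W : World} (ρ : V ⟶ W) (R : Rel W) (M N : Prog V 0) :
    (R.res ρ).mem M N ↔ R.holds ρ M N := by
  simp [mem, res]

theorem mem.res {V W : World} (ρ : V ⟶ W) {R : Rel W} {M N : Prog W 0} (h : R.mem M N) :
    (R.res ρ).mem (M.res ρ) (N.res ρ) := by
  have := R.mono ρ (𝟙 W) M N h
  rw [mem_res]
  simpa using this

theorem res_comp {V' V W : World} (σ : V' ⟶ V) (ρ : V ⟶ W) (R : Rel W) :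
    (R.res ρ).res σ = R.res (σ ≫ ρ) := by
  ext; simp [Rel.res]

/-- Closure of a relation under evaluation to canonical form. -/
def valClo {W : World} (R : Rel W) : Rel W where
  holds _ ρ M₀ M₁ := ∃ v₀ v₁, M₀.Eval v₀ ∧ M₁.Eval v₁ ∧ R.holds ρ v₀ v₁
  mono := by
    rintro V V' σ ρ M₀ M₁ ⟨v₀, v₁, h₀, h₁, h⟩
    exact ⟨_, _, h₀.res σ, h₁.res σ, R.mono σ ρ _ _ h⟩

end Rel

/-- Elements at `W` of the exponential of relations by closed programs. -/
@[ext]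
structure ProgRel (W : World) where
  app : ∀ ⦃V : World⦄, (V ⟶ W) → Prog V 0 → Rel V
  nat : ∀ ⦃V V' : World⦄ (σ : V' ⟶ V) (ρ : V ⟶ W) (M : Prog V 0),
    (app ρ M).res σ = app (σ ≫ ρ) (M.res σ)

def ProgRel.res {V W : World} (ρ : V ⟶ W) (B : ProgRel W) : ProgRel V where
  app _ σ M := B.app (σ ≫ ρ) M
  nat _ _ σ' σ M := by simpa using B.nat σ' (σ ≫ ρ) M

theorem ProgRel.res_comp {V' V W : World} (σ : V' ⟶ V) (ρ : V ⟶ W) (B : ProgRel W) :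
    (B.res ρ).res σ = B.res (σ ≫ ρ) := by
  ext; simp [ProgRel.res]

/-- Elements at `W` of the exponential of relations by the object of clock names. -/
@[ext]
structure ClkRel (W : World) where
  app : ∀ ⦃V : World⦄, (V ⟶ W) → Clk V → Rel V
  nat : ∀ ⦃V V' : World⦄ (σ : V' ⟶ V) (ρ : V ⟶ W) (κ : Clk V),
    (app ρ κ).res σ = app (σ ≫ ρ) (clkRes σ κ)

def ClkRel.res {V W : World} (ρ : V ⟶ W) (A : ClkRel W) : ClkRel V where
  app _ σ κ := A.app (σ ≫ ρ) κ
  nat _ _ σ' σ κ := by simpa using A.nat σ' (σ ≫ ρ) κ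

mutual

/-- The canonical natural numbers and their equality: the least relation `Y` that relates `ze` to
itself, and `su M₀` to `su M₁` whenever `M₀` and `M₁` are related by the closure of `Y` under
evaluation. -/
inductive NatVal {W : World} : Prog W 0 → Prog W 0 → Prop
  | ze {M₀ M₁ : Prog W 0} : M₀.1 = .ze → M₁.1 = .ze → NatVal M₀ M₁
  | su {M₀ M₁ N₀ N₁ : Prog W 0} : M₀.1 = .su N₀.1 → M₁.1 = .su N₁.1 → NatClo N₀ N₁ →
      NatVal M₀ M₁

/-- The closure of `NatVal` under evaluation. -/
inductive NatClo {W : World} : Prog W 0 → Prog W 0 → Prop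
  | eval {M₀ M₁ v₀ v₁ : Prog W 0} : M₀.Eval v₀ → M₁.Eval v₁ → NatVal v₀ v₁ → NatClo M₀ M₁

end

mutual

theorem NatVal.res {V W : World} (ρ : V ⟶ W) {M₀ M₁ : Prog W 0} :
    NatVal M₀ M₁ → NatVal (M₀.res ρ) (M₁.res ρ)
  | .ze h₀ h₁ => .ze (by simp [Prog.res, h₀, Raw.restrict]) (by simp [Prog.res, h₁, Raw.restrict])
  | .su (N₀ := N₀) (N₁ := N₁) h₀ h₁ h =>
    .su (N₀ := N₀.res ρ) (N₁ := N₁.res ρ) (by simp [Prog.res, h₀, Raw.restrict])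
      (by simp [Prog.res, h₁, Raw.restrict]) (NatClo.res ρ h)

theorem NatClo.res {V W : World} (ρ : V ⟶ W) {M₀ M₁ : Prog W 0} :
    NatClo M₀ M₁ → NatClo (M₀.res ρ) (M₁.res ρ)
  | .eval h₀ h₁ h => .eval (h₀.res ρ) (h₁.res ρ) (NatVal.res ρ h)

end

mutual

/-- The canonical elements of a wellordering type and their equality: the least relation `Y` that
relates `sup P₀ N₀` to `sup P₁ N₁` whenever `(P₀, P₁) ∈ A` and, for all `(O₀, O₁) ∈ B P₀`,
`N₀[O₀]` and `N₁[O₁]` are related by the closure of `Y` under evaluation. -/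
inductive WVal : ∀ {W : World}, Rel W → ProgRel W → Prog W 0 → Prog W 0 → Prop
  | sup {W : World} {A : Rel W} {B : ProgRel W} {M₀ M₁ P₀ P₁ : Prog W 0} {N₀ N₁ : Prog W 1} :
      M₀.1 = .sup P₀.1 N₀.1 → M₁.1 = .sup P₁.1 N₁.1 → A.mem P₀ P₁ →
      (∀ ⦃V : World⦄ (ρ : V ⟶ W) (O₀ O₁ : Prog V 0),
        (B.app ρ (P₀.res ρ)).mem O₀ O₁ →
          WClo (A.res ρ) (B.res ρ) ((N₀.res ρ).inst O₀) ((N₁.res ρ).inst O₁)) →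
      WVal A B M₀ M₁

/-- The closure of `WVal` under evaluation. -/
inductive WClo : ∀ {W : World}, Rel W → ProgRel W → Prog W 0 → Prog W 0 → Prop
  | eval {W : World} {A : Rel W} {B : ProgRel W} {M₀ M₁ v₀ v₁ : Prog W 0} :
      M₀.Eval v₀ → M₁.Eval v₁ → WVal A B v₀ v₁ → WClo A B M₀ M₁

end

theorem WVal.res {V W : World} (ρ : V ⟶ W) {A : Rel W} {B : ProgRel W} {M₀ M₁ : Prog W 0}
    (h : WVal A B M₀ M₁) : WVal (A.res ρ) (B.res ρ) (M₀.res ρ) (M₁.res ρ) := by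
  obtain @⟨_, _, _, _, _, P₀, P₁, N₀, N₁, h₀, h₁, hP, hN⟩ := h
  refine .sup (P₀ := P₀.res ρ) (P₁ := P₁.res ρ) (N₀ := N₀.res ρ) (N₁ := N₁.res ρ)
    (by simp [Prog.res, h₀, Raw.restrict]) (by simp [Prog.res, h₁, Raw.restrict]) (hP.res ρ) ?_
  intro V' σ O₀ O₁ hO
  have := hN (σ ≫ ρ) O₀ O₁ (by simpa [ProgRel.res, Prog.res_comp] using hO)
  simpa [Prog.res_comp, Rel.res_comp, ProgRel.res_comp] using this

namespace Rel

/-! The relations that interpret the type formers. -/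

def void (W : World) : Rel W where
  holds _ _ _ _ := False
  mono _ _ _ _ _ _ h := h

def unit (W : World) : Rel W where
  holds _ _ M₀ M₁ := M₀.1 = .star ∧ M₁.1 = .star
  mono := by
    rintro V V' σ ρ M₀ M₁ ⟨h₀, h₁⟩
    simp [Prog.res, h₀, h₁, Raw.restrict]

def bool (W : World) : Rel W where
  holds _ _ M₀ M₁ := (M₀.1 = .tt ∧ M₁.1 = .tt) ∨ (M₀.1 = .ff ∧ M₁.1 = .ff)
  mono := by
    rintro V V' σ ρ M₀ M₁ (⟨h₀, h₁⟩ | ⟨h₀, h₁⟩) <;>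
    simp [Prog.res, h₀, h₁, Raw.restrict]

def nat (W : World) : Rel W where
  holds _ _ M₀ M₁ := NatVal M₀ M₁
  mono _ _ σ _ _ _ h := h.res σ

def sigma {W : World} (A : Rel W) (B : ProgRel W) : Rel W where
  holds _ ρ M₀ M₁ := A.holds ρ M₀.fst M₁.fst ∧ (B.app ρ M₀.fst).mem M₀.snd M₁.snd
  mono := by
    rintro V V' σ ρ M₀ M₁ ⟨h₀, h₁⟩
    refine ⟨A.mono σ ρ _ _ h₀, ?_⟩
    have := h₁.res σ
    rwa [B.nat] at this

def pi {W : World} (A : Rel W) (B : ProgRel W) : Rel W where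
  holds V ρ M₀ M₁ := ∀ ⦃V' : World⦄ (σ : V' ⟶ V) (N₀ N₁ : Prog V' 0), A.holds (σ ≫ ρ) N₀ N₁ →
    (B.app (σ ≫ ρ) N₀).mem ((M₀.res σ).app N₀) ((M₁.res σ).app N₁)
  mono := by
    intro V V' σ ρ M₀ M₁ h V'' σ' N₀ N₁ hN
    have := h (σ' ≫ σ) N₀ N₁ (by simpa using hN)
    simpa [Prog.res_comp] using this

def wty {W : World} (A : Rel W) (B : ProgRel W) : Rel W where
  holds _ ρ M₀ M₁ := WVal (A.res ρ) (B.res ρ) M₀ M₁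
  mono := by
    intro V V' σ ρ M₀ M₁ h
    simpa [Rel.res_comp, ProgRel.res_comp] using h.res σ

def eq {W : World} (A : Rel W) (P₀ P₁ : Prog W 0) : Rel W where
  holds _ ρ M₀ M₁ := M₀.1 = .star ∧ M₁.1 = .star ∧ A.holds ρ (P₀.res ρ) (P₁.res ρ)
  mono := by
    rintro V V' σ ρ M₀ M₁ ⟨h₀, h₁, h⟩
    refine ⟨by simp [Prog.res, h₀, Raw.restrict], by simp [Prog.res, h₁, Raw.restrict], ?_⟩
    simpa [Prog.res_comp] using A.mono σ ρ _ _ h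

def later {W : World} (κ : Clk W) (A : Rel W) : Rel W where
  holds _ ρ M₀ M₁ :=
    Later (clkRes ρ κ) (fun _ σ => A.holds (σ ≫ ρ) (M₀.res σ) (M₁.res σ))
  mono := by
    intro V V' σ ρ M₀ M₁ h
    have := Later.res σ (clkRes ρ κ) (fun V₁ V₂ τ₁ τ₂ h' => by
      simpa [Prog.res_comp] using A.mono τ₁ (τ₂ ≫ ρ) _ _ h') h
    simpa [Prog.res_comp] using this

def isect {W : World} (A : ClkRel W) : Rel W where
  holds V ρ M₀ M₁ := ∀ ⦃V' : World⦄ (σ : V' ⟶ V) (κ : Clk V'),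
    (A.app (σ ≫ ρ) κ).mem (M₀.res σ) (M₁.res σ)
  mono := by
    intro V V' σ ρ M₀ M₁ h V'' σ' κ
    simpa [Prog.res_comp] using h (σ' ≫ σ) κ

def kprod {W : World} (A : ClkRel W) : Rel W where
  holds V ρ M₀ M₁ := ∀ ⦃V' : World⦄ (σ : V' ⟶ V) (κ : Clk V'),
    (A.app (σ ≫ ρ) κ).mem ((M₀.res σ).kapp κ) ((M₁.res σ).kapp κ)
  mono := by
    intro V V' σ ρ M₀ M₁ h V'' σ' κ
    simpa [Prog.res_comp] using h (σ' ≫ σ) κ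

end Rel

/-! ## Candidate type systems -/

/-- A candidate type system: a relation between closed programs and relations on closed programs
in the topos. -/
@[ext]
structure CTS where
  mem : ∀ ⦃W : World⦄, Prog W 0 → Rel W → Prop
  mono : ∀ ⦃V W : World⦄ (ρ : V ⟶ W) (A : Prog W 0) (R : Rel W), mem A R →
    mem (A.res ρ) (R.res ρ)

namespace CTS

/-- Inclusion of candidate type systems. -/
instance : LE CTS := ⟨fun τ τ' => ∀ ⦃W : World⦄ (A : Prog W 0) (R : Rel W), τ.mem A R → τ'.mem A R⟩

/-- The empty candidate type system. -/
instance : Bot CTS := ⟨⟨fun _ _ _ => False, fun _ _ _ _ _ h => h⟩⟩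

/-- Union of candidate type systems. -/
instance : Union CTS := ⟨fun τ τ' =>
  ⟨fun _ A R => τ.mem A R ∨ τ'.mem A R, fun _ _ ρ A R h => h.imp (τ.mono ρ A R) (τ'.mono ρ A R)⟩⟩

/-- `A` and `B` are similar types. -/
def SimType (τ : CTS) {W : World} (A B : Prog W 0) : Prop :=
  ∃ R : Rel W, τ.mem A R ∧ τ.mem B R

/-- `M₀` and `M₁` are similar elements of `A`. -/
def SimMem (τ : CTS) {W : World} (M₀ M₁ A : Prog W 0) : Prop :=
  ∃ R : Rel W, τ.mem A R ∧ R.mem M₀ M₁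

/-- Closure of a candidate type system under evaluation to canonical form. -/
def valClo (τ : CTS) : CTS where
  mem _ A R := ∃ v, A.Eval v ∧ τ.mem v R
  mono := by
    rintro V W ρ A R ⟨v, hv, h⟩
    exact ⟨_, hv.res ρ, τ.mono ρ _ _ h⟩

/-- `B` is a family of types over `A`, with relations given by `Bs`, functional in the sense that
`B[M₀]` and `B[M₁]` are both interpreted by both of `Bs M₀` and `Bs M₁` for `(M₀, M₁) ∈ A`. -/
def Functional (τ : CTS) {W : World} (As : Rel W) (B : Prog W 1) (Bs : ProgRel W) : Prop :=
  ∀ ⦃V : World⦄ (ρ : V ⟶ W) (M₀ M₁ : Prog V 0), As.holds ρ M₀ M₁ →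
    τ.mem ((B.res ρ).inst M₀) (Bs.app ρ M₀) ∧ τ.mem ((B.res ρ).inst M₁) (Bs.app ρ M₀) ∧
    τ.mem ((B.res ρ).inst M₁) (Bs.app ρ M₁) ∧ τ.mem ((B.res ρ).inst M₀) (Bs.app ρ M₁)

theorem Functional.res {τ : CTS} {V W : World} (ρ : V ⟶ W) {As : Rel W} {B : Prog W 1}
    {Bs : ProgRel W} (h : τ.Functional As B Bs) :
    τ.Functional (As.res ρ) (B.res ρ) (Bs.res ρ) := by
  intro V' σ M₀ M₁ hM
  simpa [Prog.res_comp, ProgRel.res] using h (σ ≫ ρ) M₀ M₁ hM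

def cloVoid : CTS where
  mem W T X := T.1 = .void ∧ X = Rel.void W
  mono := by
    rintro V W ρ T X ⟨hT, rfl⟩
    exact ⟨by simp [Prog.res, hT, Raw.restrict], rfl⟩

def cloUnit : CTS where
  mem W T X := T.1 = .unit ∧ X = (Rel.unit W).valClo
  mono := by
    rintro V W ρ T X ⟨hT, rfl⟩
    exact ⟨by simp [Prog.res, hT, Raw.restrict], rfl⟩

def cloBool : CTS where
  mem W T X := T.1 = .bool ∧ X = (Rel.bool W).valClo
  mono := by
    rintro V W ρ T X ⟨hT, rfl⟩
    exact ⟨by simp [Prog.res, hT, Raw.restrict], rfl⟩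

def cloNat : CTS where
  mem W T X := T.1 = .nat ∧ X = (Rel.nat W).valClo
  mono := by
    rintro V W ρ T X ⟨hT, rfl⟩
    exact ⟨by simp [Prog.res, hT, Raw.restrict], rfl⟩

def cloProd (τ : CTS) : CTS where
  mem W T X := ∃ (A : Prog W 0) (B : Prog W 1), T.1 = .sg A.1 B.1 ∧
    ∃ (As : Rel W) (Bs : ProgRel W), τ.mem A As ∧ τ.Functional As B Bs ∧ X = Rel.sigma As Bs
  mono := by
    rintro V W ρ T X ⟨A, B, hT, As, Bs, hA, hB, rfl⟩
    exact ⟨A.res ρ, B.res ρ, by simp [Prog.res, hT, Raw.restrict], As.res ρ, Bs.res ρ,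
      τ.mono ρ _ _ hA, hB.res ρ, rfl⟩

def cloFun (τ : CTS) : CTS where
  mem W T X := ∃ (A : Prog W 0) (B : Prog W 1), T.1 = .pi A.1 B.1 ∧
    ∃ (As : Rel W) (Bs : ProgRel W), τ.mem A As ∧ τ.Functional As B Bs ∧ X = Rel.pi As Bs
  mono := by
    rintro V W ρ T X ⟨A, B, hT, As, Bs, hA, hB, rfl⟩
    refine ⟨A.res ρ, B.res ρ, by simp [Prog.res, hT, Raw.restrict], As.res ρ, Bs.res ρ,
      τ.mono ρ _ _ hA, hB.res ρ, ?_⟩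
    ext; simp [Rel.res, ProgRel.res, Rel.pi]

def cloW (τ : CTS) : CTS where
  mem W T X := ∃ (A : Prog W 0) (B : Prog W 1), T.1 = .wty A.1 B.1 ∧
    ∃ (As : Rel W) (Bs : ProgRel W), τ.mem A As ∧ τ.Functional As B Bs ∧
      X = (Rel.wty As Bs).valClo
  mono := by
    rintro V W ρ T X ⟨A, B, hT, As, Bs, hA, hB, rfl⟩
    refine ⟨A.res ρ, B.res ρ, by simp [Prog.res, hT, Raw.restrict], As.res ρ, Bs.res ρ,
      τ.mono ρ _ _ hA, hB.res ρ, ?_⟩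
    ext; simp [Rel.res, Rel.valClo, Rel.wty, ProgRel.res]

def cloEq (τ : CTS) : CTS where
  mem W T X := ∃ A P₀ P₁ : Prog W 0, T.1 = .eq A.1 P₀.1 P₁.1 ∧
    ∃ As : Rel W, τ.mem A As ∧ As.mem P₀ P₀ ∧ As.mem P₁ P₁ ∧ X = (Rel.eq As P₀ P₁).valClo
  mono := by
    rintro V W ρ T X ⟨A, P₀, P₁, hT, As, hA, h₀, h₁, rfl⟩
    refine ⟨A.res ρ, P₀.res ρ, P₁.res ρ, by simp [Prog.res, hT, Raw.restrict], As.res ρ,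
      τ.mono ρ _ _ hA, h₀.res ρ, h₁.res ρ, ?_⟩
    ext; simp [Rel.res, Rel.valClo, Rel.eq, Prog.res_comp]

def cloLater (τ : CTS) : CTS where
  mem W T X := ∃ (κ : Clk W) (A : Prog W 0), T.1 = .later κ A.1 ∧
    ∃ As : Rel W, Later κ (fun _ ρ => τ.mem (A.res ρ) (As.res ρ)) ∧ X = Rel.later κ As
  mono := by
    rintro V W ρ T X ⟨κ, A, hT, As, hA, rfl⟩
    refine ⟨clkRes ρ κ, A.res ρ, by simp [Prog.res, hT, Raw.restrict], As.res ρ, ?_, ?_⟩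
    · have := Later.res ρ κ (fun V₁ V₂ σ₁ σ₂ h' => by
        simpa [Prog.res_comp, Rel.res_comp] using τ.mono σ₁ _ _ h') hA
      simpa [Prog.res_comp, Rel.res_comp] using this
    · ext; simp [Rel.res, Rel.later]

def cloIsect (τ : CTS) : CTS where
  mem W T X := ∃ A : ClkProg W, T.1 = .isect A.raw ∧
    ∃ As : ClkRel W, (∀ ⦃V : World⦄ (ρ : V ⟶ W) (κ : Clk V), τ.mem (A.app ρ κ) (As.app ρ κ)) ∧
      X = Rel.isect As
  mono := by
    rintro V W ρ T X ⟨A, hT, As, hA, rfl⟩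
    refine ⟨A.res ρ, by simp only [Prog.res, hT, Raw.restrict]; rfl, As.res ρ,
      fun V' σ κ => hA (σ ≫ ρ) κ, ?_⟩
    ext; simp [Rel.res, Rel.isect, ClkRel.res]

def cloKFun (τ : CTS) : CTS where
  mem W T X := ∃ A : ClkProg W, T.1 = .kprod A.raw ∧
    ∃ As : ClkRel W, (∀ ⦃V : World⦄ (ρ : V ⟶ W) (κ : Clk V), τ.mem (A.app ρ κ) (As.app ρ κ)) ∧
      X = Rel.kprod As
  mono := by
    rintro V W ρ T X ⟨A, hT, As, hA, rfl⟩
    refine ⟨A.res ρ, by simp only [Prog.res, hT, Raw.restrict]; rfl, As.res ρ,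
      fun V' σ κ => hA (σ ≫ ρ) κ, ?_⟩
    ext; simp [Rel.res, Rel.kprod, ClkRel.res]

/-- All non-universe connectives. -/
def conns (τ : CTS) : CTS :=
  cloVoid ∪ cloUnit ∪ cloBool ∪ cloNat ∪ cloProd τ ∪ cloFun τ ∪ cloKFun τ ∪ cloEq τ ∪
    cloLater τ ∪ cloIsect τ ∪ cloW τ

/-- The operator whose least fixed point is the closure of `σ` under the connectives. -/
def step (σ τ : CTS) : CTS := σ ∪ (conns τ).valClo

/-- The closure of `σ` under the connectives: the least (pre-)fixed point of the monotone operator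
`step σ`, as the intersection of all its pre-fixed points. -/
def close (σ : CTS) : CTS where
  mem _ A R := ∀ τ : CTS, step σ τ ≤ τ → τ.mem A R
  mono _ _ ρ A R h τ hτ := τ.mono ρ A R (h τ hτ)

/-- The relation of similarity of types in `τ`. -/
def simRel (τ : CTS) (W : World) : Rel W where
  holds _ _ A₀ A₁ := τ.SimType A₀ A₁
  mono := by
    rintro V V' σ ρ A₀ A₁ ⟨R, h₀, h₁⟩
    exact ⟨_, τ.mono σ _ _ h₀, τ.mono σ _ _ h₁⟩

/-- The universes `U_i` with `i ≤ n`, where `U_i` classifies the types of `τ i`. -/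
def universes (n : ℕ) (τ : ∀ i, i ≤ n → CTS) : CTS where
  mem W T X := ∃ (i : ℕ) (hi : i ≤ n), T.1 = .univ i ∧ X = (τ i hi).simRel W
  mono := by
    rintro V W ρ T X ⟨i, hi, hT, rfl⟩
    exact ⟨i, hi, by simp [Prog.res, hT, Raw.restrict], rfl⟩

/-- The spine of the universe hierarchy. -/
def spine : ℕ → CTS
  | 0 => ⊥
  | n + 1 => (universes n (fun i _ => close (spine i))).valClo

/-- The `n`-th level of the hierarchy of type systems. -/
def tower (n : ℕ) : CTS := close (spine n)

/-- The union of the hierarchy. -/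
def omega : CTS where
  mem _ A R := ∃ n, (tower n).mem A R
  mono := by
    rintro V W ρ A R ⟨n, h⟩
    exact ⟨n, (tower n).mono ρ A R h⟩

/-! ## Sequents and judgments -/

/-- Similarity of instantiations of a telescope. -/
def SimEnv (τ : CTS) {W : World} : {n : ℕ} → Tele W n → (γ₀ γ₁ : Fin n → Prog W 0) → Prop
  | _, .nil, _, _ => True
  | _, .snoc Γ A, γ₀, γ₁ => τ.SimEnv Γ (fun i => γ₀ i.succ) (fun i => γ₁ i.succ) ∧
      τ.SimMem (γ₀ 0) (γ₁ 0) (A.subst (fun i => γ₀ i.succ))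

/-- Open type similarity (type functionality). -/
def HypSimType (τ : CTS) {W : World} {n : ℕ} (Γ : Tele W n) (A₀ A₁ : Prog W n) : Prop :=
  ∀ ⦃V : World⦄ (ρ : V ⟶ W) (γ₀ γ₁ : Fin n → Prog V 0), τ.SimEnv (Γ.res ρ) γ₀ γ₁ →
    τ.SimType ((A₀.res ρ).subst γ₀) ((A₁.res ρ).subst γ₁)

/-- Open member similarity (functionality). -/
def HypSimMem (τ : CTS) {W : World} {n : ℕ} (Γ : Tele W n) (M₀ M₁ A : Prog W n) : Prop :=
  ∀ ⦃V : World⦄ (ρ : V ⟶ W) (γ₀ γ₁ : Fin n → Prog V 0), τ.SimEnv (Γ.res ρ) γ₀ γ₁ →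
    τ.SimMem ((M₀.res ρ).subst γ₀) ((M₁.res ρ).subst γ₁) ((A.res ρ).subst γ₀)

/-- Context validity. -/
def IsCtx (τ : CTS) {W : World} : {n : ℕ} → Tele W n → Prop
  | _, .nil => True
  | _, .snoc Γ A => τ.IsCtx Γ ∧ τ.HypSimType Γ A A

end CTS

/-- The meaning, at the world `W`, of the judgment that `M₀` and `M₁` are equal elements of `A` in
the context `Γ`, where `l` is the number of clocks of the clock context. -/
def EqMemAt (W : World) {l n : ℕ} (Γ : FCtx l n) (M₀ M₁ A : FTm l n) : Prop :=
  ∀ ⦃V : World⦄, (V ⟶ W) → ∀ ϱ : Fin l → Clk V,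
    CTS.omega.IsCtx (Γ.sem ϱ) →
    CTS.omega.HypSimType (Γ.sem ϱ) (A.sem ϱ) (A.sem ϱ) →
    CTS.omega.HypSimMem (Γ.sem ϱ) (M₀.sem ϱ) (M₁.sem ϱ) (A.sem ϱ)

/-- The judgment `Δ | Γ ⊢ M₀ = M₁ ∈ A` is valid, i.e. true at all worlds. -/
def EqMem {l n : ℕ} (Γ : FCtx l n) (M₀ M₁ A : FTm l n) : Prop :=
  ∀ W : World, EqMemAt W Γ M₀ M₁ A

/-- The judgment `Δ | Γ ⊢ M ∈ A` is valid. -/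
def IsMem {l n : ℕ} (Γ : FCtx l n) (M A : FTm l n) : Prop := EqMem Γ M M A

/-! ## The examples -/

/-- `λ k. fix A. bool × ▷ₖ A`. -/
def stream {l n : ℕ} : FTm l n := .klam (.fix (.prod .bool (.later 0 (.var 0))))

/-- `⋂ k. stream k`. -/
def sequence {l n : ℕ} : FTm l n := .isect (.kapp stream 0)

/-- `fix x. ⟨tt, x⟩`. -/
def ones {l n : ℕ} : FTm l n := .fix (.pair .tt (.var 0))

end GCTT

/-!
Every program that occurs in the six judgments is closed, so the context plays no role and all that
matters is the behaviour of a few concrete programs at each world.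

The relation that interprets guarded streams over a clock `κ` is the guarded fixed point
`R κ = bool × ▷ κ (R κ)`, realised by the inductive predicate `StreamRel`. To see that it does
interpret `fix A. bool × ▷ κ A`, it is enough to work in an arbitrary type system `τ` closed under
the connectives, since `close σ` is the intersection of such systems; there the claim follows by
induction on the time left on `κ`, which is Löb induction (`CTS.Closed.streamFix_mem`). Both sides of
the unfolding of `Stream k` are then interpreted by `R κ`, and `ones` belongs to `R κ` by a second
Löb induction (`StreamRel.of_reduces_ones`).

Sequences are interpreted by `⋂ κ. R κ`. The unfolding of sequences is the equation
`⋂ κ. R κ = bool × ⋂ κ. R κ` (`seqRel_eq`). Clock irrelevance for `bool` holds because worlds are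
non-empty. The cancellation of the later modality under a clock quantifier uses a fresh clock: to
obtain `R κ` from `∀ κ. ▷ κ (R κ)`, add a clock with one more unit of time left than `κ`
(`World.extend`), let it tick, and identify it with `κ` (`World.collapse`).

All of this holds in every closed type system, hence at every level of the universe hierarchy.
-/

namespace GCTT

/-! ### Worlds and ticks -/

/-- Restriction along any morphism commutes with ticks, up to a morphism between the worlds that
are reached by the ticks. -/
theorem World.exists_tick_comp {V W : World} (ρ : V ⟶ W) (κ : Clk W) {m : ℕ}
    (hm : V.time (clkRes ρ κ) = m + 1) :
    ∃ (n : ℕ) (hn : W.time κ = n + 1) (σ : V.set (clkRes ρ κ) m ⟶ W.set κ n),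
      World.tick hm ≫ ρ = σ ≫ World.tick hn :=
  -- The morphisms that factor through a tick of `κ` are stable under precomposition.
  Later.res ρ κ
    (φ := fun V' τ => ∃ (n : ℕ) (hn : W.time κ = n + 1) (σ : V' ⟶ W.set κ n),
      τ = σ ≫ World.tick hn)
    (fun _ _ σ _ ⟨n, hn, σ', h⟩ => ⟨n, hn, σ ≫ σ', by rw [h, Category.assoc]⟩)
    (fun n hn => ⟨n, hn, 𝟙 _, (Category.id_comp _).symm⟩) m hm

/-- The world `W` with one more clock, on which the time left is `n`. The new clock has name `0`. -/
def World.extend (W : World) (n : ℕ) : World where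
  card := W.card + 1
  pos := W.card.succ_pos
  time := Fin.cons n W.time

/-- The projection that forgets the new clock. -/
def World.weaken (W : World) (n : ℕ) : W.extend n ⟶ W where
  names := Fin.succ
  le _ := le_rfl

/-- The new clock, once the time left on it is at least that on `κ`, can be identified with `κ`. -/
def World.collapse {W : World} (κ : Clk W) (m n : ℕ) (h : W.time κ ≤ n) :
    W ⟶ (W.extend m).set (0 : Fin (W.card + 1)) n where
  names := (Fin.cons κ id : Fin (W.card + 1) → Fin W.card)
  le := by
    intro (κ' : Fin (W.card + 1))
    change _ ≤ Function.update (Fin.cons m W.time : Fin (W.card + 1) → ℕ) 0 n κ'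
    refine Fin.cases ?_ (fun j => ?_) κ'
    · simpa using h
    · simp

theorem World.collapse_comp {W : World} (κ : Clk W) {m n : ℕ} (h : W.time κ ≤ n)
    (hm : (W.extend m).time (0 : Fin (W.card + 1)) = n + 1) :
    World.collapse κ m n h ≫ World.tick hm ≫ World.weaken W m = 𝟙 W := rfl

/-! ### The relations interpreting streams and sequences -/

/-- Equality of guarded streams over the clock `κ`: the heads are equal booleans and the tails are,
one tick of `κ` later, equal streams. As the recursion is guarded, this least fixed point is the
only one. -/
inductive StreamRel : ∀ {W : World}, Clk W → Prog W 0 → Prog W 0 → Prop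
  | mk {W : World} {κ : Clk W} {M N : Prog W 0} :
      (Rel.bool W).valClo.mem M.fst N.fst →
      (∀ (n : ℕ) (h : W.time κ = n + 1),
        StreamRel (W := W.set κ n) κ (M.snd.res (World.tick h)) (N.snd.res (World.tick h))) →
      StreamRel κ M N

theorem StreamRel.res {W : World} {κ : Clk W} {M N : Prog W 0} (h : StreamRel κ M N) {V : World}
    (ρ : V ⟶ W) : StreamRel (clkRes ρ κ) (M.res ρ) (N.res ρ) := by
  induction h generalizing V with
  | @mk W κ M N hb _ ih =>
    refine .mk (hb.res ρ) (fun m hm => ?_)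
    obtain ⟨n, hn, σ, e⟩ := World.exists_tick_comp ρ κ hm
    have hκ : clkRes σ (κ : Clk (W.set κ n)) = clkRes ρ κ :=
      (congrArg (fun τ => clkRes τ κ) e).symm
    have h := ih n hn σ
    rw [Prog.res_comp, Prog.res_comp, ← e, ← Prog.res_comp, ← Prog.res_comp, hκ] at h
    exact h

/-- The constant family of relations. -/
def ProgRel.const {W : World} (R : Rel W) : ProgRel W where
  app _ ρ _ := R.res ρ
  nat _ _ σ ρ _ := R.res_comp σ ρ

/-- `StreamRel κ` as a relation in the topos. -/
def streamRel {W : World} (κ : Clk W) : Rel W where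
  holds _ ρ M N := StreamRel (clkRes ρ κ) M N
  mono _ _ σ _ _ _ h := h.res σ

/-- The fixed point equation of the relation of guarded streams. -/
theorem streamRel_eq {W : World} (κ : Clk W) :
    streamRel κ = Rel.sigma (Rel.bool W).valClo (ProgRel.const (Rel.later κ (streamRel κ))) := by
  ext V ρ M N
  exact ⟨fun ⟨hb, ht⟩ => ⟨hb, ht⟩, fun ⟨hb, ht⟩ => ⟨hb, ht⟩⟩

/-- The relations of guarded streams, as a family indexed by clocks. -/
def streamClkRel (W : World) : ClkRel W where
  app _ _ κ := streamRel κ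
  nat _ _ _ _ _ := rfl

/-- The relation that interprets sequences. -/
def seqRel (W : World) : Rel W := Rel.isect (streamClkRel W)

theorem seqRel_holds {V W : World} {ρ : V ⟶ W} {M N : Prog V 0} :
    (seqRel W).holds ρ M N ↔
      ∀ ⦃V' : World⦄ (σ : V' ⟶ V) (κ : Clk V'), StreamRel κ (M.res σ) (N.res σ) :=
  Iff.rfl

/-- A later modality under a quantification over its clock can be cancelled. -/
theorem StreamRel.of_forall_later {W : World} {M N : Prog W 0}
    (h : ∀ ⦃V : World⦄ (σ : V ⟶ W) (κ : Clk V),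
      Later κ (fun _ τ => StreamRel (clkRes τ κ) (M.res (τ ≫ σ)) (N.res (τ ≫ σ))))
    (κ : Clk W) : StreamRel κ M N := by
  have hm : (W.extend (W.time κ + 1)).time (0 : Fin (W.card + 1)) = W.time κ + 1 := rfl
  have := (h (World.weaken W _) (0 : Fin (W.card + 1)) _ hm).res
    (World.collapse κ _ _ le_rfl)
  rw [Prog.res_comp, Prog.res_comp, World.collapse_comp, Prog.res_id, Prog.res_id] at this
  exact this

theorem seqRel_eq (W : World) :
    seqRel W = Rel.sigma (Rel.bool W).valClo (ProgRel.const (seqRel W)) := by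
  ext V ρ M N
  constructor
  · intro h
    refine ⟨?_, ?_⟩
    · change (Rel.bool V).valClo.mem _ _
      -- The head does not depend on the clock, and `V` has at least one clock.
      obtain ⟨hb, -⟩ := h (𝟙 V) ⟨0, V.pos⟩
      simpa only [Prog.res_id] using hb
    · rw [ProgRel.const, Rel.mem_res, seqRel_holds]
      intro V' σ
      refine StreamRel.of_forall_later fun V'' σ' κ n hn => ?_
      obtain ⟨-, ht⟩ := h (σ' ≫ σ) κ
      have := ht n hn
      rw [← Prog.res_comp, ← Prog.res_comp, Prog.res_comp σ', Prog.res_comp σ']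
      exact this
  · rintro ⟨hb, ht⟩ V' σ κ
    rw [ProgRel.const, Rel.mem_res, seqRel_holds] at ht
    refine .mk ((Rel.bool W).valClo.mono σ ρ _ _ hb) (fun n hn => ?_)
    exact (ht σ κ).res (World.tick hn)

/-! ### Weakening of closed programs -/

theorem Raw.lift_liftRen {W : World} {k m n : ℕ} (r : Fin k → Fin m) (γ : Fin m → Raw W n) :
    (fun i => Raw.lift γ (liftRen r i)) = Raw.lift (fun i => γ (r i)) := by
  funext i
  refine Fin.cases rfl (fun j => rfl) i

theorem Raw.subst_rename {W : World} {k m n : ℕ} (r : Fin k → Fin m) (γ : Fin m → Raw W n)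
    (M : Raw W k) : (M.rename r).subst γ = M.subst (fun i => γ (r i)) := by
  induction M generalizing m n <;> simp_all [Raw.rename, Raw.subst, Raw.lift_liftRen]

theorem Raw.lift_var {W : World} {n : ℕ} :
    Raw.lift (W := W) (.var : Fin n → Raw W n) = .var := by
  funext i
  refine Fin.cases rfl (fun j => rfl) i

theorem Raw.subst_var {W : World} {n : ℕ} (M : Raw W n) : M.subst .var = M := by
  induction M <;> simp_all [Raw.subst, Raw.lift_var, Raw.restrict]

theorem Raw.inst_rename_succ {W : World} (A M : Raw W 0) :
    (A.rename Fin.succ).inst M = A := by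
  rw [Raw.inst, Raw.subst_rename]
  exact (congrArg (A.subst ·) (funext fun i => i.elim0)).trans A.subst_var

/-! ### The programs of the examples -/

/-- `fix A. bool × ▷ κ A`, to which `Stream κ` reduces. -/
def streamFix {W : World} (κ : Clk W) : Prog W 0 :=
  ⟨.fix (.sg .bool (.later κ (.var 1))), trivial, trivial⟩

/-- The program `Stream`. -/
def streamProg (W : World) : Prog W 0 :=
  ⟨.klam (fun _ _ κ => (streamFix κ).1), fun _ _ κ => (streamFix κ).2, fun _ _ _ _ _ => rfl⟩

/-- The family `Stream κ`, indexed by clocks. -/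
def streamClkProg (W : World) : ClkProg W where
  app V _ κ := (streamProg V).kapp κ
  nat _ _ _ _ _ := rfl

/-- The program `Sequence`. -/
def seqProg (W : World) : Prog W 0 :=
  ⟨.isect (streamClkProg W).raw, fun V _ κ => ((streamProg V).kapp κ).2, fun _ _ _ _ _ => rfl⟩

/-- The program `ones`. -/
def onesProg (W : World) : Prog W 0 := ⟨.fix (.pair .tt (.var 0)), trivial, trivial⟩

/-- The program `▷ κ A`. -/
def Prog.later {W : World} (κ : Clk W) (A : Prog W 0) : Prog W 0 := ⟨.later κ A.1, A.2⟩

/-- The program `bool × A`. -/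
def Prog.boolProd {W : World} (A : Prog W 0) : Prog W 0 :=
  ⟨.sg .bool (A.1.rename Fin.succ), trivial, A.2.rename _⟩

theorem streamFix_eval {W : World} (κ : Clk W) :
    (streamFix κ).Eval ((streamFix κ).later κ).boolProd :=
  ⟨.single .fix, trivial⟩

theorem stream_kapp_eval {W : World} (κ : Clk W) :
    ((streamProg W).kapp κ).Eval ((streamFix κ).later κ).boolProd :=
  ⟨.head .kapp_klam (streamFix_eval κ).1, trivial⟩

theorem fst_reduces {W : World} {M M' : Raw W 0} (h : Relation.ReflTransGen Step M M') :
    Relation.ReflTransGen Step M.fst M'.fst :=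
  h.lift _ fun _ _ => .fst_cong

theorem snd_reduces {W : World} {M M' : Raw W 0} (h : Relation.ReflTransGen Step M M') :
    Relation.ReflTransGen Step M.snd M'.snd :=
  h.lift _ fun _ _ => .snd_cong

theorem reduces_restrict {V W : World} (ρ : V ⟶ W) {M N : Raw W 0} (hM : M.Natural)
    (h : Relation.ReflTransGen Step M N) :
    Relation.ReflTransGen Step (M.restrict ρ) (N.restrict ρ) := by
  induction h using Relation.ReflTransGen.head_induction_on with
  | refl => exact .refl
  | head hs _ ih => exact .head (hs.restrict ρ hM) (ih (hs.natural hM))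

/-- Programs that reduce to `ones` are equal guarded streams. The induction is over all such
programs because the tail of `ones` is not `ones` itself but only reduces to it. -/
theorem StreamRel.of_reduces_ones {W : World} (κ : Clk W) {M N : Prog W 0}
    (hM : Relation.ReflTransGen Step M.1 (onesProg W).1)
    (hN : Relation.ReflTransGen Step N.1 (onesProg W).1) : StreamRel κ M N := by
  induction ht : W.time κ using Nat.strong_induction_on generalizing W with
  | _ t ih =>
    have head {L : Prog W 0} (hL : Relation.ReflTransGen Step L.1 (onesProg W).1) :
        L.fst.Eval ⟨.tt, trivial⟩ :=
      ⟨(fst_reduces hL).trans (.head (.fst_cong .fix) (.single .fst_pair)), trivial⟩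
    have tail {L : Prog W 0} (hL : Relation.ReflTransGen Step L.1 (onesProg W).1) :
        Relation.ReflTransGen Step L.snd.1 (onesProg W).1 :=
      (snd_reduces hL).trans (.head (.snd_cong .fix) (.single .snd_pair))
    refine .mk ⟨_, _, head hM, head hN, .inl ⟨rfl, rfl⟩⟩ (fun n h => ?_)
    refine ih n (by omega) (W := W.set κ n) κ ?_ ?_ (Function.update_self ..)
    · exact reduces_restrict (World.tick h) M.snd.2 (tail hM)
    · exact reduces_restrict (World.tick h) N.snd.2 (tail hN)

/-! ### Type systems closed under the connectives -/

namespace CTS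

/-- Closure of a type system under the non-universe connectives, up to evaluation. -/
def Closed (τ : CTS) : Prop := (conns τ).valClo ≤ τ

theorem mem_union {τ τ' : CTS} {W : World} {A : Prog W 0} {R : Rel W} :
    (τ ∪ τ').mem A R ↔ τ.mem A R ∨ τ'.mem A R := Iff.rfl

theorem mem_close {σ : CTS} {W : World} {A : Prog W 0} {R : Rel W}
    (h : ∀ τ : CTS, σ ≤ τ → τ.Closed → τ.mem A R) : (close σ).mem A R :=
  fun τ hτ => h τ (fun _ _ _ hA => hτ _ _ (.inl hA)) (fun _ _ _ hA => hτ _ _ (.inr hA))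

namespace Closed

theorem of_conns {τ : CTS} (hτ : τ.Closed) {W : World} {A v : Prog W 0} {R : Rel W}
    (hA : A.Eval v) (h : (conns τ).mem v R) : τ.mem A R :=
  hτ _ _ ⟨v, hA, h⟩

theorem bool_mem {τ : CTS} (hτ : τ.Closed) {W : World} {T : Prog W 0} (hT : T.1 = .bool) :
    τ.mem T (Rel.bool W).valClo := by
  refine hτ.of_conns ⟨.refl, by rw [hT]; trivial⟩ ?_
  have : cloBool.mem T (Rel.bool W).valClo := ⟨hT, rfl⟩
  simp only [conns, mem_union]
  tauto

theorem boolProd_mem {τ : CTS} (hτ : τ.Closed) {W : World} {T A : Prog W 0} {R : Rel W}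
    (hT : T.Eval A.boolProd) (hA : τ.mem A R) :
    τ.mem T (Rel.sigma (Rel.bool W).valClo (ProgRel.const R)) := by
  refine hτ.of_conns hT ?_
  have hB ⦃V : World⦄ (ρ : V ⟶ W) (M : Prog V 0) :
      τ.mem (Prog.inst (Prog.res ρ ⟨A.1.rename Fin.succ, A.2.rename _⟩) M) (R.res ρ) := by
    have e : Prog.inst (Prog.res ρ ⟨A.1.rename Fin.succ, A.2.rename _⟩) M = A.res ρ :=
      Prog.ext ((congrArg (Raw.inst · M.1) (Raw.rename_restrict ρ _ A.1)).trans
        (Raw.inst_rename_succ _ _))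
    exact e ▸ τ.mono ρ _ _ hA
  have : (cloProd τ).mem A.boolProd (Rel.sigma (Rel.bool W).valClo (ProgRel.const R)) :=
    ⟨⟨Raw.bool, (trivial : True)⟩, ⟨A.1.rename Fin.succ, A.2.rename _⟩, rfl, _, _,
      hτ.bool_mem rfl, fun V ρ M₀ M₁ _ => ⟨hB ρ M₀, hB ρ M₁, hB ρ M₁, hB ρ M₀⟩, rfl⟩
  simp only [conns, mem_union]
  tauto

theorem later_mem {τ : CTS} (hτ : τ.Closed) {W : World} {κ : Clk W} {A : Prog W 0} {R : Rel W}
    (hA : Later κ (fun _ ρ => τ.mem (A.res ρ) (R.res ρ))) :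
    τ.mem (A.later κ) (Rel.later κ R) := by
  refine hτ.of_conns ⟨.refl, trivial⟩ ?_
  have : (cloLater τ).mem (A.later κ) (Rel.later κ R) := ⟨κ, A, rfl, R, hA, rfl⟩
  simp only [conns, mem_union]
  tauto

theorem isect_mem {τ : CTS} (hτ : τ.Closed) {W : World} {T : Prog W 0} {A : ClkProg W}
    {As : ClkRel W} (hT : T.1 = .isect A.raw)
    (hA : ∀ ⦃V : World⦄ (ρ : V ⟶ W) (κ : Clk V), τ.mem (A.app ρ κ) (As.app ρ κ)) :
    τ.mem T (Rel.isect As) := by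
  refine hτ.of_conns ⟨.refl, by rw [hT]; trivial⟩ ?_
  have : (cloIsect τ).mem T (Rel.isect As) := ⟨A, hT, As, hA, rfl⟩
  simp only [conns, mem_union]
  tauto

theorem kprod_mem {τ : CTS} (hτ : τ.Closed) {W : World} {T : Prog W 0} {A : ClkProg W}
    {As : ClkRel W} (hT : T.1 = .kprod A.raw)
    (hA : ∀ ⦃V : World⦄ (ρ : V ⟶ W) (κ : Clk V), τ.mem (A.app ρ κ) (As.app ρ κ)) :
    τ.mem T (Rel.kprod As) := by
  refine hτ.of_conns ⟨.refl, by rw [hT]; trivial⟩ ?_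
  have : (cloKFun τ).mem T (Rel.kprod As) := ⟨A, hT, As, hA, rfl⟩
  simp only [conns, mem_union]
  tauto

theorem streamFix_mem {τ : CTS} (hτ : τ.Closed) {W : World} (κ : Clk W) :
    τ.mem (streamFix κ) (streamRel κ) := by
  induction ht : W.time κ using Nat.strong_induction_on generalizing W with
  | _ t ih =>
    rw [streamRel_eq]
    refine hτ.boolProd_mem (streamFix_eval κ) (hτ.later_mem fun n h => ?_)
    exact ih n (by omega) (W := W.set κ n) κ (Function.update_self ..)

theorem stream_mem {τ : CTS} (hτ : τ.Closed) {W : World} (κ : Clk W) :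
    τ.mem ((streamProg W).kapp κ) (streamRel κ) := by
  rw [streamRel_eq]
  exact hτ.boolProd_mem (stream_kapp_eval κ)
    (hτ.later_mem fun _ h => hτ.streamFix_mem (clkRes (World.tick h) κ))

theorem stream_unfold_mem {τ : CTS} (hτ : τ.Closed) {W : World} (κ : Clk W) :
    τ.mem (((streamProg W).kapp κ).later κ).boolProd (streamRel κ) := by
  rw [streamRel_eq]
  exact hτ.boolProd_mem ⟨.refl, trivial⟩
    (hτ.later_mem fun _ h => hτ.stream_mem (clkRes (World.tick h) κ))

theorem seq_mem {τ : CTS} (hτ : τ.Closed) (W : World) : τ.mem (seqProg W) (seqRel W) :=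
  hτ.isect_mem (A := streamClkProg W) rfl fun _ _ κ => hτ.stream_mem κ

theorem seq_unfold_mem {τ : CTS} (hτ : τ.Closed) (W : World) :
    τ.mem (seqProg W).boolProd (seqRel W) := by
  rw [seqRel_eq]
  exact hτ.boolProd_mem ⟨.refl, trivial⟩ (hτ.seq_mem W)

end Closed

/-! ### The universe hierarchy -/

/-- What holds in every closed type system holds at every level of the hierarchy. -/
theorem tower_mem {W : World} {A : Prog W 0} {R : Rel W}
    (h : ∀ τ : CTS, τ.Closed → τ.mem A R) (n : ℕ) : (tower n).mem A R :=
  mem_close fun τ _ hτ => h τ hτ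

theorem omega_mem {W : World} {A : Prog W 0} {R : Rel W}
    (h : ∀ τ : CTS, τ.Closed → τ.mem A R) : omega.mem A R :=
  ⟨0, tower_mem h 0⟩

theorem spine_succ_univ_mem (i : ℕ) {W : World} {T : Prog W 0} (hT : T.1 = .univ i) :
    (spine (i + 1)).mem T ((tower i).simRel W) := by
  rw [spine]
  exact ⟨T, ⟨.refl, by rw [hT]; trivial⟩, i, le_rfl, hT, rfl⟩

theorem omega_univ_mem (i : ℕ) {W : World} {T : Prog W 0} (hT : T.1 = .univ i) :
    omega.mem T ((tower i).simRel W) :=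
  ⟨i + 1, mem_close fun _ hσ _ => hσ _ _ (spine_succ_univ_mem i hT)⟩

theorem omega_kprod_univ_mem (i : ℕ) {W : World} {T : Prog W 0}
    (hT : T.1 = .kprod fun _ _ _ => .univ i) :
    omega.mem T (Rel.kprod ⟨fun V _ _ => (tower i).simRel V, fun _ _ _ _ _ => rfl⟩) :=
  ⟨i + 1, mem_close fun _ hσ hτ =>
    hτ.kprod_mem (A := ⟨fun _ _ _ => ⟨.univ i, trivial⟩, fun _ _ _ _ _ => rfl⟩) hT
      fun _ _ _ => hσ _ _ (spine_succ_univ_mem i rfl)⟩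

/-- Types with a common interpretation in all closed type systems are equal in `U_i`. -/
theorem omega_simMem_univ (i : ℕ) {W : World} {A B T : Prog W 0} {R : Rel W}
    (hT : T.1 = .univ i) (hA : ∀ τ : CTS, τ.Closed → τ.mem A R)
    (hB : ∀ τ : CTS, τ.Closed → τ.mem B R) : omega.SimMem A B T :=
  ⟨_, omega_univ_mem i hT, R, tower_mem hA i, tower_mem hB i⟩

end CTS

end GCTT

theorem mainTheorem7 :
    -- the type of guarded streams is an element of the clock product of universes
    (∀ (l n : ℕ) (Γ : GCTT.FCtx l n) (i : ℕ),
      GCTT.IsMem Γ GCTT.stream (.kprod (.univ i))) ∧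
    -- the type of sequences is an element of the universe
    (∀ (l n : ℕ) (Γ : GCTT.FCtx l n) (i : ℕ),
      GCTT.IsMem Γ GCTT.sequence (.univ i)) ∧
    -- unfolding of guarded streams at the clock with index 0
    (∀ (l n : ℕ) (Γ : GCTT.FCtx (l + 1) n) (i : ℕ),
      GCTT.EqMem Γ (.kapp GCTT.stream 0)
        (.prod .bool (.later 0 (.kapp GCTT.stream 0))) (.univ i)) ∧
    -- unfolding of sequences
    (∀ (l n : ℕ) (Γ : GCTT.FCtx l n) (i : ℕ),
      GCTT.EqMem Γ GCTT.sequence (.prod .bool GCTT.sequence) (.univ i)) ∧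
    -- `ones` is a guarded stream
    (∀ (l n : ℕ) (Γ : GCTT.FCtx (l + 1) n),
      GCTT.IsMem Γ GCTT.ones (.kapp GCTT.stream 0)) ∧
    -- `ones` is a sequence
    (∀ (l n : ℕ) (Γ : GCTT.FCtx l n),
      GCTT.IsMem Γ GCTT.ones GCTT.sequence) := by
  refine ⟨?_, ?_, ?_, ?_, ?_, ?_⟩
  · intro l n Γ i W V _ ϱ _ _ V' ρ γ₀ γ₁ _
    exact ⟨_, GCTT.CTS.omega_kprod_univ_mem i rfl, fun U _ κ =>
      ⟨_, GCTT.CTS.tower_mem (fun _ hτ => hτ.stream_mem κ) i,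
        GCTT.CTS.tower_mem (fun _ hτ => hτ.stream_mem κ) i⟩⟩
  · intro l n Γ i W V _ ϱ _ _ V' ρ γ₀ γ₁ _
    exact GCTT.CTS.omega_simMem_univ i rfl (fun _ hτ => hτ.seq_mem V')
      (fun _ hτ => hτ.seq_mem V')
  · intro l n Γ i W V _ ϱ _ _ V' ρ γ₀ γ₁ _
    exact GCTT.CTS.omega_simMem_univ i rfl
      (fun _ hτ => hτ.stream_mem (GCTT.clkRes ρ (ϱ 0)))
      (fun _ hτ => hτ.stream_unfold_mem (GCTT.clkRes ρ (ϱ 0)))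
  · intro l n Γ i W V _ ϱ _ _ V' ρ γ₀ γ₁ _
    exact GCTT.CTS.omega_simMem_univ i rfl (fun _ hτ => hτ.seq_mem V')
      (fun _ hτ => hτ.seq_unfold_mem V')
  · intro l n Γ W V _ ϱ _ _ V' ρ γ₀ γ₁ _
    exact ⟨_, GCTT.CTS.omega_mem fun _ hτ => hτ.stream_mem (GCTT.clkRes ρ (ϱ 0)),
      GCTT.StreamRel.of_reduces_ones _ .refl .refl⟩
  · intro l n Γ W V _ ϱ _ _ V' ρ γ₀ γ₁ _
    exact ⟨_, GCTT.CTS.omega_mem fun _ hτ => hτ.seq_mem V', fun _ _ κ =>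
      GCTT.StreamRel.of_reduces_ones κ .refl .refl⟩
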